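/- For a group $G$ let $S(G)$ be the group of permutations of the set $G$, and let $\rho(G)\le S(G)$ be the image of the right regular representation, i.e. the group of all maps $h\mapsto hg$ with $g\in G$. Put $\mathrm{Hol}(G)=N_{S(G)}(\rho(G))$ and $T(G)=N_{S(G)}(\mathrm{Hol}(G))/\mathrm{Hol}(G)$. **Theorem.** Let $p>2$ be a prime, let $n\ge 2$, and let $G$ be the free group on $n$ generators in the variety of groups of nilpotency class at most two and exponent dividing $p$; that is, $G$ is isomorphic to the quotient of the free group $F$ of rank $n$ by the normal subgroup generated by all $x^p$ and all $[[x,y],z]$ with $x,y,z\in F$. Then $T(G)$ is cyclic of order $p-1$. Moreover, for every integer $d$ coprime to $p$ the power map $\theta_d\colon x\mapsto x^d$ is a permutation of $G$ lying in $N_{S(G)}(\mathrm{Hol}(G))$, and every element of $T(G)$ is the class of $\theta_d$ for some integer $d$ coprime to $p$. -/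

import Mathlib

namespace MultipleHolomorph

open scoped commutatorElement

section Holomorph

variable (G : Type*) [Group G]

/-- The image of the right regular representation: the subgroup of the group of permutations of
the set `G` consisting of the maps `h ↦ h * g`, for `g` in `G`. -/
def rightRegular : Subgroup (Equiv.Perm G) :=
  (MulAction.toPermHom Gᵐᵒᵖ G).range

theorem mem_rightRegular (σ : Equiv.Perm G) :
    σ ∈ rightRegular G ↔ ∃ g : G, ∀ h : G, σ h = h * g := by
  constructor
  · rintro ⟨g, rfl⟩
    exact ⟨g.unop, fun h => rfl⟩
  · rintro ⟨g, hg⟩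
    exact ⟨MulOpposite.op g, Equiv.ext fun h => (hg h).symm⟩

/-- The holomorph of `G`: the normalizer of the right regular representation in the group of
permutations of the set `G`. -/
def holomorph : Subgroup (Equiv.Perm G) :=
  Subgroup.normalizer (rightRegular G : Set (Equiv.Perm G))

/-- The multiple holomorph of `G`: the normalizer of the holomorph. -/
def multipleHolomorph : Subgroup (Equiv.Perm G) :=
  Subgroup.normalizer (holomorph G : Set (Equiv.Perm G))

instance holomorph_normal :
    ((holomorph G).subgroupOf (multipleHolomorph G)).Normal :=
  Subgroup.normal_in_normalizer

/-- The group `T(G)`: the quotient of the multiple holomorph by the holomorph. -/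
abbrev T : Type _ :=
  multipleHolomorph G ⧸ (holomorph G).subgroupOf (multipleHolomorph G)

end Holomorph

/-- The verbal subgroup of the free group on `n` generators defined by the laws `x ^ p = 1`
and `[[x, y], z] = 1`. -/
def lawSubgroup (n p : ℕ) : Subgroup (FreeGroup (Fin n)) :=
  Subgroup.normalClosure
    ({w | ∃ x : FreeGroup (Fin n), w = x ^ p} ∪
      {w | ∃ x y z : FreeGroup (Fin n), w = ⁅⁅x, y⁆, z⁆})

instance lawSubgroup_normal (n p : ℕ) : (lawSubgroup n p).Normal :=
  Subgroup.normalClosure_normal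

/-- The free group on `n` generators in the variety of groups of nilpotency class at most two
and exponent dividing `p`. -/
abbrev FreeClassTwo (n p : ℕ) : Type :=
  FreeGroup (Fin n) ⧸ lawSubgroup n p

end MultipleHolomorph

/-! The holomorph consists of the maps `x ↦ α x * g` with `α` an automorphism, so the stabilizer of
`1` in it is `Aut G`. Modulo the holomorph, an element of the multiple holomorph can be taken to be
some `τ` with `τ 1 = 1`. Transport the multiplication along it: `x ∘ y = τ (τ⁻¹ x * τ⁻¹ y)`. This
operation is associative and `Aut G`-invariant, and its translations lie in the holomorph.

Relative freeness supplies enough automorphisms to determine such an operation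
(`exists_eq_mul_commutator_zpow`). Inverting single generators confines `X i ∘ X j` to the subgroup
generated by `X i` and `X j` (`mem_closure_of_flip_eq`) and fixes its two linear exponents at `1`
modulo `p`, leaving only an exponent `c` on the commutator. Permutations, transvections and
associativity then spread this to `x ∘ y = x * y * ⁅x, y⁆ ^ c` everywhere.

Since `G` is not abelian, neither is `∘`, which forces `1 + 2c ≠ 0` modulo `p`. By
`mul_pow_eq_of_class_two`, the power map with exponent `d = (1 + 2c)⁻¹` transports the
multiplication to the same operation, so it differs from `τ` by an automorphism. Hence the power
maps give a surjection of `(ZMod p)ˣ` onto `T G`. It is injective because a power map that is an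
automorphism sends a commutator both to its `d`-th and to its `d²`-th power. -/

namespace MultipleHolomorph

open scoped commutatorElement

/-! ### Commutator calculus in class two. -/

section ClassTwo

variable {G : Type*} [Group G]

theorem commute_commutator (h2 : ∀ x y z : G, ⁅⁅x, y⁆, z⁆ = 1) (x y z : G) :
    Commute ⁅x, y⁆ z :=
  commutatorElement_eq_one_iff_commute.mp (h2 x y z)

theorem commutator_mem_center (h2 : ∀ x y z : G, ⁅⁅x, y⁆, z⁆ = 1) (x y : G) :
    ⁅x, y⁆ ∈ Subgroup.center G :=
  Subgroup.mem_center_iff.mpr fun z => (commute_commutator h2 x y z).eq.symm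

/-- In a group of class at most two, commutation with a fixed element is a homomorphism. -/
def commutatorHom (h2 : ∀ x y z : G, ⁅⁅x, y⁆, z⁆ = 1) (y : G) : G →* G where
  toFun x := ⁅x, y⁆
  map_one' := by simp
  map_mul' a b := by
    have h := (commute_commutator h2 b y a).eq
    calc ⁅a * b, y⁆ = (a * ⁅b, y⁆) * y * a⁻¹ * y⁻¹ := by
          simp only [commutatorElement_def]; group
      _ = (⁅b, y⁆ * a) * y * a⁻¹ * y⁻¹ := by rw [h]
      _ = ⁅b, y⁆ * ⁅a, y⁆ := by simp only [commutatorElement_def]; group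
      _ = ⁅a, y⁆ * ⁅b, y⁆ := (commute_commutator h2 b y _).eq

theorem commutator_mul_left (h2 : ∀ x y z : G, ⁅⁅x, y⁆, z⁆ = 1) (a b y : G) :
    ⁅a * b, y⁆ = ⁅a, y⁆ * ⁅b, y⁆ :=
  (commutatorHom h2 y).map_mul a b

theorem commutator_zpow_left (h2 : ∀ x y z : G, ⁅⁅x, y⁆, z⁆ = 1) (a y : G) (k : ℤ) :
    ⁅a ^ k, y⁆ = ⁅a, y⁆ ^ k :=
  (commutatorHom h2 y).map_zpow a k

theorem commutator_mul_right (h2 : ∀ x y z : G, ⁅⁅x, y⁆, z⁆ = 1) (a b y : G) :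
    ⁅y, a * b⁆ = ⁅y, a⁆ * ⁅y, b⁆ := by
  rw [← commutatorElement_inv, commutator_mul_left h2, mul_inv_rev, commutatorElement_inv,
    commutatorElement_inv, (commute_commutator h2 y b _).eq]

theorem commutator_zpow_right (h2 : ∀ x y z : G, ⁅⁅x, y⁆, z⁆ = 1) (a y : G) (k : ℤ) :
    ⁅y, a ^ k⁆ = ⁅y, a⁆ ^ k := by
  rw [← commutatorElement_inv, commutator_zpow_left h2, ← inv_zpow, commutatorElement_inv]

theorem commutator_eq_one_of_mem_center {z : G} (hz : z ∈ Subgroup.center G) (x : G) :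
    ⁅z, x⁆ = 1 :=
  commutatorElement_eq_one_iff_commute.mpr ((Subgroup.mem_center_iff.mp hz x).symm)

theorem commutator_eq_one_of_mem_center' {z : G} (hz : z ∈ Subgroup.center G) (x : G) :
    ⁅x, z⁆ = 1 :=
  commutatorElement_eq_one_iff_commute.mpr (Subgroup.mem_center_iff.mp hz x)

/-- This exhibits right translation by `y` in the twisted operation as an inner automorphism
followed by ordinary right translation, so that identities in `x` can be checked on generators. -/
theorem conj_zpow_neg_eq (h2 : ∀ x y z : G, ⁅⁅x, y⁆, z⁆ = 1) (x y : G) (c : ℤ) :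
    MulAut.conj (y ^ (-c)) x = x * ⁅x, y⁆ ^ c := by
  rw [MulAut.conj_apply, show y ^ (-c) * x * (y ^ (-c))⁻¹ = ⁅y ^ (-c), x⁆ * x by
    simp only [commutatorElement_def]; group, (commute_commutator h2 _ _ _).eq,
    commutator_zpow_left h2, ← commutatorElement_inv, inv_zpow, zpow_neg, inv_inv]

/-- The operation `x * y * ⁅x, y⁆ ^ c` is associative on a group of class at most two. -/
theorem twist_assoc (h2 : ∀ x y z : G, ⁅⁅x, y⁆, z⁆ = 1) (c : ℤ) (x y z : G) :
    (x * y * ⁅x, y⁆ ^ c) * z * ⁅x * y * ⁅x, y⁆ ^ c, z⁆ ^ c =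
      x * (y * z * ⁅y, z⁆ ^ c) * ⁅x, y * z * ⁅y, z⁆ ^ c⁆ ^ c := by
  have hz (a b : G) : ⁅a, b⁆ ^ c ∈ Subgroup.center G :=
    Subgroup.zpow_mem _ (commutator_mem_center h2 a b) c
  have e1 : ⁅x * y * ⁅x, y⁆ ^ c, z⁆ = ⁅x, z⁆ * ⁅y, z⁆ := by
    rw [commutator_mul_left h2, commutator_mul_left h2, commutator_eq_one_of_mem_center (hz x y),
      mul_one]
  have e2 : ⁅x, y * z * ⁅y, z⁆ ^ c⁆ = ⁅x, y⁆ * ⁅x, z⁆ := by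
    rw [commutator_mul_right h2, commutator_mul_right h2,
      commutator_eq_one_of_mem_center' (hz y z), mul_one]
  rw [e1, e2, (commute_commutator h2 x z _).mul_zpow, (commute_commutator h2 x y _).mul_zpow]
  have hc (a b w : G) : ⁅a, b⁆ ^ c * w = w * ⁅a, b⁆ ^ c :=
    ((commute_commutator h2 a b w).zpow_left c).eq
  calc x * y * ⁅x, y⁆ ^ c * z * (⁅x, z⁆ ^ c * ⁅y, z⁆ ^ c)
      = x * y * (⁅x, y⁆ ^ c * (z * (⁅x, z⁆ ^ c * ⁅y, z⁆ ^ c))) := by simp only [mul_assoc]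
    _ = x * y * ((z * (⁅x, z⁆ ^ c * ⁅y, z⁆ ^ c)) * ⁅x, y⁆ ^ c) := by rw [hc]
    _ = x * y * z * (⁅x, z⁆ ^ c * (⁅y, z⁆ ^ c * ⁅x, y⁆ ^ c)) := by simp only [mul_assoc]
    _ = x * y * z * ((⁅y, z⁆ ^ c * ⁅x, y⁆ ^ c) * ⁅x, z⁆ ^ c) := by rw [hc x z]
    _ = _ := by simp only [mul_assoc]

/-- Moving the last `x` to the left past `y ^ d` costs `⁅y, x⁆ ^ d`; these central factors
accumulate to the exponent `0 + 1 + ... + (d - 1)`. -/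
theorem mul_pow_eq_of_class_two (h2 : ∀ x y z : G, ⁅⁅x, y⁆, z⁆ = 1) (x y : G) (d : ℕ) :
    (x * y) ^ d = x ^ d * y ^ d * ⁅y, x⁆ ^ (d.choose 2) := by
  induction d with
  | zero => simp
  | succ d ih =>
    have hc (k : ℕ) (w : G) : ⁅y, x⁆ ^ k * w = w * ⁅y, x⁆ ^ k :=
      ((commute_commutator h2 y x w).pow_left k).eq
    have h1 : y ^ d * x = x * y ^ d * ⁅y, x⁆ ^ d := by
      have := commutator_zpow_left h2 y x d
      rw [zpow_natCast, zpow_natCast] at this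
      rw [← this, ← (commute_commutator h2 _ _ _).eq]
      simp only [commutatorElement_def]; group
    calc (x * y) ^ (d + 1) = x ^ d * y ^ d * (⁅y, x⁆ ^ (d.choose 2) * (x * y)) := by
          rw [pow_succ, ih, mul_assoc]
      _ = x ^ d * (y ^ d * x) * y * ⁅y, x⁆ ^ (d.choose 2) := by rw [hc]; simp only [mul_assoc]
      _ = x ^ d * (x * y ^ d) * (⁅y, x⁆ ^ d * y) * ⁅y, x⁆ ^ (d.choose 2) := by
          rw [h1]; simp only [mul_assoc]
      _ = x ^ (d + 1) * y ^ (d + 1) * ⁅y, x⁆ ^ (d + d.choose 2) := by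
          rw [hc, pow_add ⁅y, x⁆, pow_succ x, pow_succ y]; simp only [mul_assoc]
      _ = _ := by rw [Nat.choose_succ_succ' d 1, Nat.choose_one_right]

end ClassTwo

/-! ### Exponents modulo `p`. -/

section Exponent

variable {G : Type*} [Group G] {p : ℕ}

theorem zpow_eq_zpow_of_cast_eq (hexp : ∀ x : G, x ^ p = 1) {a b : ℤ}
    (hab : (a : ZMod p) = b) (x : G) : x ^ a = x ^ b := by
  obtain ⟨k, hk⟩ := (ZMod.intCast_eq_intCast_iff_dvd_sub a b p).mp hab
  rw [show b = a + p * k by omega, zpow_add, zpow_mul, zpow_natCast, hexp, one_zpow, mul_one]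

theorem zpow_eq_one_of_cast_eq_zero (hexp : ∀ x : G, x ^ p = 1) {a : ℤ}
    (ha : (a : ZMod p) = 0) (x : G) : x ^ a = 1 := by
  rw [zpow_eq_zpow_of_cast_eq hexp (b := 0) (by simpa using ha), zpow_zero]

theorem eq_one_of_zpow_eq_one (hp : p.Prime) (hexp : ∀ x : G, x ^ p = 1) {a : ℤ}
    (ha : (a : ZMod p) ≠ 0) {x : G} (hx : x ^ a = 1) : x = 1 := by
  have := Fact.mk hp
  have h : (((a * ((a : ZMod p)⁻¹).val : ℤ)) : ZMod p) = (1 : ℤ) := by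
    push_cast
    rw [ZMod.natCast_zmod_val, mul_inv_cancel₀ ha]
  have h' := zpow_eq_zpow_of_cast_eq hexp h x
  rwa [zpow_mul, hx, one_zpow, zpow_one, eq_comm] at h'

theorem two_ne_zero_zmod (hp : p.Prime) (hp2 : 2 < p) : (2 : ZMod p) ≠ 0 := by
  have := Fact.mk hp
  intro h
  have h' : ((2 : ℕ) : ZMod p) = 0 := by exact_mod_cast h
  have := Nat.le_of_dvd two_pos ((ZMod.natCast_eq_zero_iff 2 p).mp h')
  omega

theorem eq_one_of_eq_inv (hp : p.Prime) (hp2 : 2 < p) (hexp : ∀ x : G, x ^ p = 1) {x : G}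
    (hx : x = x⁻¹) : x = 1 := by
  refine eq_one_of_zpow_eq_one hp hexp (a := 2) (by exact_mod_cast two_ne_zero_zmod hp hp2) ?_
  rw [zpow_two]
  exact mul_eq_one_iff_eq_inv.mpr hx

end Exponent

/-- `X` generates `G`, every function on `X` to `G` extends to an endomorphism, and the coordinate
functions modulo `p` exist. -/
structure IsFreeSystem {G : Type*} [Group G] {ι : Type*} [DecidableEq ι] (p : ℕ) (X : ι → G) :
    Prop where
  class_two : ∀ x y z : G, ⁅⁅x, y⁆, z⁆ = 1
  exponent : ∀ x : G, x ^ p = 1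
  closure : Subgroup.closure (Set.range X) = ⊤
  lift : ∀ h : ι → G, ∃ φ : G →* G, ∀ i, φ (X i) = h i
  coord : ∀ i, ∃ e : G →* Multiplicative (ZMod p),
    ∀ j, e (X j) = Multiplicative.ofAdd (if j = i then 1 else 0)

/-! ### Automorphisms prescribed on free generators. -/

namespace IsFreeSystem

variable {G : Type*} [Group G] {ι : Type*} [DecidableEq ι] {p : ℕ} {X : ι → G}

theorem hom_ext (hX : IsFreeSystem p X) {M : Type*} [Monoid M] {φ ψ : G →* M}
    (h : ∀ i, φ (X i) = ψ (X i)) : φ = ψ :=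
  MonoidHom.eq_of_eqOn_dense hX.closure (by rintro _ ⟨i, rfl⟩; exact h i)

theorem exists_equiv (hX : IsFreeSystem p X) (h h' : ι → G)
    (H : ∀ φ : G →* G, (∀ i, φ (X i) = h i) → ∀ i, φ (h' i) = X i)
    (H' : ∀ φ : G →* G, (∀ i, φ (X i) = h' i) → ∀ i, φ (h i) = X i) :
    ∃ φ : G ≃* G, ∀ i, φ (X i) = h i := by
  obtain ⟨φ, hφ⟩ := hX.lift h
  obtain ⟨ψ, hψ⟩ := hX.lift h'
  refine ⟨MonoidHom.toMulEquiv φ ψ (hX.hom_ext fun i => ?_) (hX.hom_ext fun i => ?_), hφ⟩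
  · simp [hφ, H' ψ hψ]
  · simp [hψ, H φ hφ]

theorem exists_flip (hX : IsFreeSystem p X) (i : ι) :
    ∃ φ : G ≃* G, φ (X i) = (X i)⁻¹ ∧ ∀ j, j ≠ i → φ (X j) = X j := by
  have H : ∀ φ : G →* G, (∀ j, φ (X j) = Function.update X i (X i)⁻¹ j) →
      ∀ j, φ (Function.update X i (X i)⁻¹ j) = X j := by
    intro φ hφ j
    by_cases hj : j = i
    · subst hj; simp [hφ]
    · simp [hφ, hj]
  obtain ⟨φ, hφ⟩ := hX.exists_equiv _ _ H H
  exact ⟨φ, by simp [hφ], fun j hj => by simp [hφ, hj]⟩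

theorem exists_perm (hX : IsFreeSystem p X) (σ : Equiv.Perm ι) :
    ∃ φ : G ≃* G, ∀ i, φ (X i) = X (σ i) :=
  hX.exists_equiv (fun i => X (σ i)) (fun i => X (σ.symm i))
    (fun φ hφ i => by simp [hφ]) (fun φ hφ i => by simp [hφ])

/-- The inverse should send `X i` to `X i * w⁻¹`, and this works when both endomorphisms fix `w`;
the disjunction on `v` covers the two of them. -/
theorem exists_mul (hX : IsFreeSystem p X) (i : ι) (w : G)
    (H : ∀ v : G, (v = w ∨ v = w⁻¹) → ∀ φ : G →* G, φ (X i) = X i * v →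
      (∀ j, j ≠ i → φ (X j) = X j) → φ w = w) :
    ∃ φ : G ≃* G, φ (X i) = X i * w ∧ ∀ j, j ≠ i → φ (X j) = X j := by
  have H1 : ∀ v : G, (v = w ∨ v = w⁻¹) → ∀ φ : G →* G,
      (∀ j, φ (X j) = Function.update X i (X i * v) j) →
      ∀ j, φ (Function.update X i (X i * v⁻¹) j) = X j := by
    intro v hv φ hφ j
    have hw := H v hv φ (by simp [hφ]) (fun j hj => by simp [hφ, hj])
    by_cases hj : j = i
    · subst hj
      rcases hv with rfl | rfl <;> simp [hφ, hw]
    · simp [hφ, hj]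
  obtain ⟨φ, hφ⟩ := hX.exists_equiv (Function.update X i (X i * w))
    (Function.update X i (X i * w⁻¹)) (H1 w (.inl rfl))
    (fun φ hφ => by simpa using H1 w⁻¹ (.inr rfl) φ hφ)
  exact ⟨φ, by simp [hφ], fun j hj => by simp [hφ, hj]⟩

theorem exists_mul_generator (hX : IsFreeSystem p X) {i k : ι} (hik : k ≠ i) :
    ∃ φ : G ≃* G, φ (X i) = X i * X k ∧ ∀ j, j ≠ i → φ (X j) = X j :=
  hX.exists_mul i (X k) fun _ _ _ _ h => h k hik

theorem exists_mul_commutator (hX : IsFreeSystem p X) (i : ι) (u v : G) :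
    ∃ φ : G ≃* G, φ (X i) = X i * ⁅u, v⁆ ∧ ∀ j, j ≠ i → φ (X j) = X j := by
  refine hX.exists_mul i _ fun w hw φ hi hj => ?_
  have hwc : w ∈ Subgroup.center G := by
    rcases hw with rfl | rfl
    · exact commutator_mem_center hX.class_two u v
    · exact inv_mem (commutator_mem_center hX.class_two u v)
  -- `φ` is the identity modulo the center, and a commutator depends only on its entries modulo the
  -- center, so `φ` fixes `⁅u, v⁆`.
  have hφ : (QuotientGroup.mk' (Subgroup.center G)).comp φ =
      QuotientGroup.mk' (Subgroup.center G) := by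
    refine hX.hom_ext fun j => ?_
    by_cases h : j = i
    · subst h
      simp only [MonoidHom.comp_apply, hi, map_mul]
      rw [(QuotientGroup.eq_one_iff w).mpr hwc |> (show QuotientGroup.mk' _ w = 1 from ·), mul_one]
    · simp [hj j h]
  have hc (x : G) : ∃ z ∈ Subgroup.center G, φ x = x * z := by
    have h : (x : G ⧸ Subgroup.center G) = φ x := (DFunLike.congr_fun hφ x).symm
    exact ⟨x⁻¹ * φ x, QuotientGroup.eq.mp h, by simp⟩
  obtain ⟨z, hz, hu⟩ := hc u
  obtain ⟨z', hz', hv⟩ := hc v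
  rw [map_commutatorElement, hu, hv, commutator_mul_left hX.class_two,
    commutator_mul_right hX.class_two, commutator_eq_one_of_mem_center hz,
    commutator_eq_one_of_mem_center' hz', mul_one, mul_one]

end IsFreeSystem

/-! ### Fixed points of the automorphisms inverting one generator. -/

namespace IsFreeSystem

variable {G : Type*} [Group G] {ι : Type*} [DecidableEq ι] {p : ℕ} {X : ι → G}

/-- Write `g = k * π g` with `k` in the kernel of the retraction `π`. That kernel is generated by
conjugates of `X i` and lies in the abelian subgroup of products of a power of `X i` and a central
element, so `φ` inverts it. Since `φ` fixes `g` and `π g`, it fixes `k`; thus `k = k⁻¹`, and `k = 1`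
as `p` is odd. -/
theorem eq_of_flip_eq (hX : IsFreeSystem p X) (hp : p.Prime) (hp2 : 2 < p) {i : ι} {φ : G ≃* G}
    (hφi : φ (X i) = (X i)⁻¹) (hφ : ∀ j, j ≠ i → φ (X j) = X j) {π : G →* G}
    (hπi : π (X i) = 1) (hπ : ∀ j, j ≠ i → π (X j) = X j) {g : G} (hg : φ g = g) : π g = g := by
  have hφπ (u : G) : φ (π u) = π u := by
    have : (φ : G →* G).comp π = π := by
      refine hX.hom_ext fun j => ?_
      by_cases hj : j = i
      · subst hj; simp [hπi]
      · simp [hπ j hj, hφ j hj]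
    exact DFunLike.congr_fun this u
  -- The last clause makes any two such `k` commute; without this, inversion would not be compatible
  -- with products.
  have key (u : G) : ∃ k : G, u = k * π u ∧ φ k = k⁻¹ ∧
      ∃ a : ℤ, ∃ z ∈ Subgroup.center G, k = X i ^ a * z := by
    have hu : u ∈ Subgroup.closure (Set.range X) := hX.closure ▸ Subgroup.mem_top u
    have hconj {l : G} (m : G) (hl : ∃ a : ℤ, ∃ z ∈ Subgroup.center G, l = X i ^ a * z) :
        ∃ a : ℤ, ∃ z ∈ Subgroup.center G, m * l * m⁻¹ = X i ^ a * z := by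
      obtain ⟨a, z, hz, rfl⟩ := hl
      refine ⟨a, ⁅X i ^ (-a), m⁆ * z,
        mul_mem (commutator_mem_center hX.class_two _ _) hz, ?_⟩
      have := Subgroup.mem_center_iff.mp hz m⁻¹
      calc m * (X i ^ a * z) * m⁻¹ = m * X i ^ a * (z * m⁻¹) := by simp only [mul_assoc]
        _ = m * X i ^ a * (m⁻¹ * z) := by rw [this]
        _ = _ := by simp only [commutatorElement_def]; group
    have hcomm {k l : G} (hk : ∃ a : ℤ, ∃ z ∈ Subgroup.center G, k = X i ^ a * z)
        (hl : ∃ a : ℤ, ∃ z ∈ Subgroup.center G, l = X i ^ a * z) : Commute k l := by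
      obtain ⟨a, z, hz, rfl⟩ := hk
      obtain ⟨b, w, hw, rfl⟩ := hl
      have hz' (v : G) : Commute v z := Subgroup.mem_center_iff.mp hz v
      have hw' (v : G) : Commute v w := Subgroup.mem_center_iff.mp hw v
      exact (((Commute.refl (X i)).zpow_zpow a b).mul_right (hw' _)).mul_left (hz' _).symm
    induction hu using Subgroup.closure_induction with
    | mem u hu =>
      obtain ⟨j, rfl⟩ := hu
      by_cases hj : j = i
      · subst hj
        exact ⟨X j, by simp [hπi], hφi, 1, 1, one_mem _, by simp⟩
      · exact ⟨1, by simp [hπ j hj], by simp, 0, 1, one_mem _, by simp⟩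
    | one => exact ⟨1, by simp, by simp, 0, 1, one_mem _, by simp⟩
    | mul u v _ _ hu hv =>
      obtain ⟨k, hk, hφk, hk'⟩ := hu
      obtain ⟨l, hl, hφl, hl'⟩ := hv
      have hl'' := hconj (π u) hl'
      refine ⟨k * (π u * l * (π u)⁻¹), ?_, ?_, ?_⟩
      · rw [map_mul]
        nth_rw 1 [hk, hl]
        group
      · have := (hcomm hk' hl'').inv_inv.eq
        rw [map_mul, map_mul, map_mul, map_inv, hφπ, hφk, hφl, mul_inv_rev, ← this]
        group
      · obtain ⟨a, z, hz, rfl⟩ := hk'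
        obtain ⟨b, w, hw, h⟩ := hl''
        refine ⟨a + b, z * w, mul_mem hz hw, ?_⟩
        rw [h, zpow_add, mul_assoc, mul_assoc, ← mul_assoc z, ← mul_assoc (X i ^ b),
          Subgroup.mem_center_iff.mp hz]
    | inv u _ hu =>
      obtain ⟨k, hk, hφk, a, z, hz, hk'⟩ := hu
      have hinv : ∃ a : ℤ, ∃ z ∈ Subgroup.center G, k⁻¹ = X i ^ a * z :=
        ⟨-a, z⁻¹, inv_mem hz, by
          rw [hk', mul_inv_rev, zpow_neg, Subgroup.mem_center_iff.mp (inv_mem hz)]⟩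
      refine ⟨(π u)⁻¹ * k⁻¹ * π u, ?_, ?_, ?_⟩
      · rw [map_inv]
        nth_rw 1 [hk]
        group
      · simp only [map_mul, map_inv, hφπ, hφk]
        group
      · simpa using hconj (π u)⁻¹ hinv
  obtain ⟨k, hk, hφk, -⟩ := key g
  have h1 : φ g = k⁻¹ * π g := by
    rw [hk, map_mul, hφk, hφπ, ← hk]
  have h2 : k = 1 := eq_one_of_eq_inv hp hp2 hX.exponent (by
    rw [hg] at h1
    exact mul_right_cancel (hk.symm.trans h1))
  rw [h2, one_mul] at hk
  exact hk.symm

/-- An element fixed by all the automorphisms inverting one generator outside `s` lies in the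
subgroup generated by the generators in `s`. -/
theorem mem_closure_of_flip_eq [Finite ι] (hX : IsFreeSystem p X) (hp : p.Prime) (hp2 : 2 < p)
    (s : Set ι) {g : G}
    (hg : ∀ i ∉ s, ∀ φ : G ≃* G, φ (X i) = (X i)⁻¹ → (∀ j, j ≠ i → φ (X j) = X j) → φ g = g) :
    g ∈ Subgroup.closure (X '' s) := by
  classical
  have := Fintype.ofFinite ι
  -- The retractions killing single generators outside `s` all fix `g`; hence so does their
  -- composite, whose image is generated by the `X i` with `i ∈ s`.
  have key (t : Finset ι) : (∀ i ∈ t, i ∉ s) →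
      ∃ π : G →* G, π g = g ∧ (∀ i ∈ t, π (X i) = 1) ∧ ∀ i ∉ t, π (X i) = X i := by
    induction t using Finset.induction_on with
    | empty => exact fun _ => ⟨MonoidHom.id G, by simp⟩
    | insert i t hi ih =>
      intro ht
      obtain ⟨π, hπg, hπ1, hπ⟩ := ih fun j hj => ht j (Finset.mem_insert_of_mem hj)
      obtain ⟨φ, hφi, hφ⟩ := hX.exists_flip i
      obtain ⟨ψ, hψ⟩ := hX.lift (Function.update X i 1)
      have hψi : ψ (X i) = 1 := by simp [hψ]
      have hψj (j : ι) (hj : j ≠ i) : ψ (X j) = X j := by simp [hψ, hj]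
      refine ⟨π.comp ψ, ?_, ?_, ?_⟩
      · rw [MonoidHom.comp_apply, hX.eq_of_flip_eq hp hp2 hφi hφ hψi hψj
          (hg i (ht i (Finset.mem_insert_self i t)) φ hφi hφ), hπg]
      · intro j hj
        by_cases hji : j = i
        · subst hji; simp [hψi]
        · simp [hψj j hji, hπ1 j (Finset.mem_of_mem_insert_of_ne hj hji)]
      · intro j hj
        rw [Finset.mem_insert, not_or] at hj
        simp [hψj j hj.1, hπ j hj.2]
  obtain ⟨π, hπg, hπ1, hπ⟩ := key (Finset.univ.filter (· ∉ s)) (by simp)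
  rw [← hπg]
  have : (⊤ : Subgroup G).map π ≤ Subgroup.closure (X '' s) := by
    rw [← hX.closure, MonoidHom.map_closure, Subgroup.closure_le]
    rintro _ ⟨_, ⟨i, rfl⟩, rfl⟩
    by_cases hi : i ∈ s
    · rw [hπ i (by simpa using hi)]
      exact Subgroup.subset_closure ⟨i, hi, rfl⟩
    · rw [hπ1 i (by simpa using hi)]
      exact one_mem _
  exact this ⟨g, Subgroup.mem_top g, rfl⟩

end IsFreeSystem

theorem exists_zpow_mul_zpow_of_mem_closure_pair {G : Type*} [Group G]
    (h2 : ∀ x y z : G, ⁅⁅x, y⁆, z⁆ = 1) {x y g : G} (hg : g ∈ Subgroup.closure {x, y}) :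
    ∃ a b c : ℤ, g = x ^ a * y ^ b * ⁅x, y⁆ ^ c := by
  have hk (c : ℤ) (v : G) : ⁅x, y⁆ ^ c * v = v * ⁅x, y⁆ ^ c :=
    ((commute_commutator h2 x y v).zpow_left c).eq
  have hyx (b a : ℤ) : y ^ b * x ^ a = x ^ a * y ^ b * ⁅x, y⁆ ^ (-(a * b)) := by
    have : ⁅x, y⁆ ^ (-(a * b)) = ⁅y ^ b, x ^ a⁆ := by
      rw [commutator_zpow_left h2, commutator_zpow_right h2, ← commutatorElement_inv x y,
        inv_zpow, inv_zpow, ← zpow_mul, zpow_neg]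
    rw [this, ← (commute_commutator h2 _ _ _).eq]
    simp only [commutatorElement_def]; group
  induction hg using Subgroup.closure_induction with
  | mem u hu =>
    rcases hu with rfl | rfl
    · exact ⟨1, 0, 0, by simp⟩
    · exact ⟨0, 1, 0, by simp⟩
  | one => exact ⟨0, 0, 0, by simp⟩
  | mul u v _ _ hu hv =>
    obtain ⟨a, b, c, rfl⟩ := hu
    obtain ⟨a', b', c', rfl⟩ := hv
    refine ⟨a + a', b + b', c + c' - a' * b, ?_⟩
    calc x ^ a * y ^ b * ⁅x, y⁆ ^ c * (x ^ a' * y ^ b' * ⁅x, y⁆ ^ c')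
        = x ^ a * (y ^ b * (⁅x, y⁆ ^ c * (x ^ a' * (y ^ b' * ⁅x, y⁆ ^ c')))) := by
          simp only [mul_assoc]
      _ = x ^ a * (y ^ b * x ^ a') * y ^ b' * (⁅x, y⁆ ^ c' * ⁅x, y⁆ ^ c) := by
          rw [hk]; simp only [mul_assoc]
      _ = x ^ a * x ^ a' * y ^ b * (⁅x, y⁆ ^ (-(a' * b)) * y ^ b') *
            (⁅x, y⁆ ^ c' * ⁅x, y⁆ ^ c) := by
          rw [hyx]; simp only [mul_assoc]
      _ = x ^ (a + a') * y ^ (b + b') *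
            (⁅x, y⁆ ^ (-(a' * b)) * (⁅x, y⁆ ^ c' * ⁅x, y⁆ ^ c)) := by
          rw [hk, zpow_add, zpow_add]; simp only [mul_assoc]
      _ = _ := by rw [← zpow_add, ← zpow_add]; congr 2; ring
  | inv u _ hu =>
    obtain ⟨a, b, c, rfl⟩ := hu
    refine ⟨-a, -b, -c - a * b, ?_⟩
    rw [mul_inv_rev, mul_inv_rev, ← zpow_neg, ← zpow_neg, ← zpow_neg, hyx, hk, mul_assoc,
      ← zpow_add]
    congr 2
    ring

/-! ### Invariant associative operations are commutator twists. -/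

section Twist

variable {G : Type*} [Group G] {ι : Type*} [DecidableEq ι] {p : ℕ} {X : ι → G}

/-- An associative operation on a relatively free group of class two and exponent `p` that is
invariant under automorphisms and whose translations lie in the holomorph is a twist of the
multiplication by a power of the commutator. -/
theorem exists_eq_mul_commutator_zpow [Finite ι] (hX : IsFreeSystem p X) (hp : p.Prime)
    (hp2 : 2 < p) {i j : ι} (hij : i ≠ j) (f : G → G → G)
    (hf : ∀ (φ : G ≃* G) (x y : G), φ (f x y) = f (φ x) (φ y))
    (hassoc : ∀ x y z, f (f x y) z = f x (f y z))
    (hr : ∀ y, ∃ α : G ≃* G, ∀ x, f x y = α x * y)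
    (hl : ∀ x, ∃ β : G ≃* G, ∀ y, f x y = β y * x) :
    ∃ c : ℤ, ∀ x y, f x y = x * y * ⁅x, y⁆ ^ c := by
  have h2 := hX.class_two
  obtain ⟨a, b, c, habc⟩ : ∃ a b c : ℤ, f (X i) (X j) = X i ^ a * X j ^ b * ⁅X i, X j⁆ ^ c := by
    refine exists_zpow_mul_zpow_of_mem_closure_pair h2 ?_
    rw [← Set.image_pair]
    refine hX.mem_closure_of_flip_eq hp hp2 _ fun k hk φ _ hφ => ?_
    simp only [Set.mem_insert_iff, Set.mem_singleton_iff, not_or] at hk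
    rw [hf, hφ i (Ne.symm hk.1), hφ j (Ne.symm hk.2)]
  have hcoord (k : ι) : ∃ e : G →* Multiplicative (ZMod p), e (X k) = Multiplicative.ofAdd 1 ∧
      ∀ l, l ≠ k → e (X l) = 1 := by
    obtain ⟨e, he⟩ := hX.coord k
    exact ⟨e, by simp [he], fun l hl => by simp [he, hl]⟩
  have half {a : ℤ} (h : (a : ZMod p) - 1 = -(a - 1)) : (a : ZMod p) = (1 : ℤ) := by
    have := Fact.mk hp
    have h' : (2 : ZMod p) * (a - 1) = 0 := by linear_combination h
    rw [Int.cast_one]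
    exact sub_eq_zero.mp ((mul_eq_zero.mp h').resolve_left (two_ne_zero_zmod hp hp2))
  have ecomm (e : G →* Multiplicative (ZMod p)) (x y : G) : e ⁅x, y⁆ = 1 := by
    rw [map_commutatorElement, commutatorElement_eq_one_iff_mul_comm, mul_comm]
  -- The `X j`-coordinate of `α (X i)` is `b - 1`. Inverting `X i` negates it, as `α` is a
  -- homomorphism, but leaves it unchanged by invariance of `f`, as `X j` is fixed.
  have hb : (b : ZMod p) = (1 : ℤ) := by
    obtain ⟨α, hα⟩ := hr (X j)
    obtain ⟨φ, hφi, hφ⟩ := hX.exists_flip i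
    obtain ⟨e, hej, he⟩ := hcoord j
    have h1 := hf φ (X i) (X j)
    rw [habc, hφi, hφ j hij.symm, hα, map_inv] at h1
    have h3 := hα (X i)
    rw [habc] at h3
    have e1 := congrArg (Multiplicative.toAdd ∘ e) h1
    have e3 := congrArg (Multiplicative.toAdd ∘ e) h3
    simp [hφi, hφ j hij.symm, hej, he i hij, ecomm] at e1 e3
    exact half (by linear_combination e1 + e3)
  have ha : (a : ZMod p) = (1 : ℤ) := by
    obtain ⟨β, hβ⟩ := hl (X i)
    obtain ⟨φ, hφj, hφ⟩ := hX.exists_flip j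
    obtain ⟨e, hei, he⟩ := hcoord i
    have h1 := hf φ (X i) (X j)
    rw [habc, hφj, hφ i hij, hβ, map_inv] at h1
    have h3 := hβ (X j)
    rw [habc] at h3
    have e1 := congrArg (Multiplicative.toAdd ∘ e) h1
    have e3 := congrArg (Multiplicative.toAdd ∘ e) h3
    simp [hφj, hφ i hij, hei, he j hij.symm, ecomm] at e1 e3
    exact half (by linear_combination e1 + e3)
  rw [zpow_eq_zpow_of_cast_eq hX.exponent ha, zpow_eq_zpow_of_cast_eq hX.exponent hb,
    zpow_one, zpow_one] at habc
  refine ⟨c, ?_⟩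
  have hstable (φ : G ≃* G) {x y : G} (h : f x y = x * y * ⁅x, y⁆ ^ c) :
      f (φ x) (φ y) = φ x * φ y * ⁅φ x, φ y⁆ ^ c := by
    rw [← hf, h]; simp [map_commutatorElement]
  have hright {y : G} {α : G ≃* G} (hα : ∀ x, f x y = α x * y) {x : G} :
      f x y = x * y * ⁅x, y⁆ ^ c ↔ α x = MulAut.conj (y ^ (-c)) x := by
    rw [hα, conj_zpow_neg_eq h2, mul_assoc, ← (commute_commutator h2 x y y).zpow_left c |>.eq,
      ← mul_assoc, mul_left_inj]
  have hj (x : G) : f x (X j) = x * X j * ⁅x, X j⁆ ^ c := by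
    obtain ⟨α, hα⟩ := hr (X j)
    have hk (k : ι) (hkj : k ≠ j) : f (X k) (X j) = X k * X j * ⁅X k, X j⁆ ^ c := by
      obtain ⟨φ, hφ⟩ := hX.exists_perm (Equiv.swap i k)
      have := hstable φ habc
      rwa [hφ, hφ, Equiv.swap_apply_left, Equiv.swap_apply_of_ne_of_ne hij.symm hkj.symm] at this
    -- The pair `(X i * X j, X j)` is an automorphic image of `(X i, X j)`, so `α` and the
    -- conjugation agree on `X i * X j` as well as on `X i`; cancel.
    have hjj : α (X j) = MulAut.conj (X j ^ (-c)) (X j) := by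
      obtain ⟨φ, hφi, hφ⟩ := hX.exists_mul_generator hij.symm
      have := hstable φ habc
      rw [hφi, hφ j hij.symm, hright hα, map_mul, map_mul, (hright hα).mp habc] at this
      exact mul_left_cancel this
    have : (α : G →* G) = (MulAut.conj (X j ^ (-c)) : G ≃* G) := by
      refine hX.hom_ext fun k => ?_
      by_cases hkj : k = j
      · subst hkj; exact hjj
      · exact (hright hα).mp (hk k hkj)
    exact (hright hα).mpr (DFunLike.congr_fun this x)
  -- `Y` is stable under automorphisms and, both operations being associative, under the twisted
  -- product. It remains to pass from the twisted product to the ordinary one.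
  let Y : Set G := {y | ∀ x, f x y = x * y * ⁅x, y⁆ ^ c}
  have hYaut (φ : G ≃* G) {y : G} (hy : y ∈ Y) : φ y ∈ Y := fun x => by
    simpa using hstable φ (hy (φ.symm x))
  have hYmul {y y' : G} (hy : y ∈ Y) (hy' : y' ∈ Y) : y * y' * ⁅y, y'⁆ ^ c ∈ Y := fun x => by
    rw [← hy' y, ← hassoc, hy', hy, hy' y]
    exact twist_assoc h2 c x y y'
  -- Powers start at `1` because `1 ∈ Y` is not yet known; it is later obtained as a `p`-th power,
  -- and inverses as `(p - 1)`-th powers.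
  have hYpow {y : G} (hy : y ∈ Y) (n : ℕ) : y ^ (n + 1) ∈ Y := by
    induction n with
    | zero => simpa using hy
    | succ n ih =>
      have h : ⁅y ^ (n + 1), y⁆ = 1 :=
        commutatorElement_eq_one_iff_commute.mpr ((Commute.refl y).pow_left _)
      simpa [h, ← pow_succ] using hYmul ih hy
  have hYinv {y : G} (hy : y ∈ Y) : y⁻¹ ∈ Y := by
    have h : y⁻¹ = y ^ (p - 2 + 1) := by
      rw [inv_eq_iff_mul_eq_one, ← pow_succ', show p - 2 + 1 + 1 = p by omega, hX.exponent]
    exact h ▸ hYpow hy _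
  have hYone : (1 : G) ∈ Y := by
    have h := hYpow (y := X j) hj (p - 1)
    rwa [show p - 1 + 1 = p by omega, hX.exponent] at h
  -- `X j * ⁅u, v⁆` is an automorphic image of `X j`, and it commutes with `(X j)⁻¹`, so their
  -- twisted product is just `⁅u, v⁆`.
  have hYcomm (u v : G) : ⁅u, v⁆ ∈ Y := by
    obtain ⟨φ, hφ, -⟩ := hX.exists_mul_commutator j u v
    have h1 := hYaut φ (y := X j) hj
    have h3 := hYmul (hYinv (y := X j) hj) h1
    have h4 : ⁅(X j)⁻¹, X j * ⁅u, v⁆⁆ = 1 := by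
      rw [commutator_mul_right h2,
        commutator_eq_one_of_mem_center' (commutator_mem_center h2 u v), mul_one]
      exact commutatorElement_eq_one_iff_commute.mpr (Commute.refl _).inv_left
    simpa [hφ, h4] using h3
  have hYcommpow (u v : G) (k : ℤ) : ⁅u, v⁆ ^ k ∈ Y := by
    rw [← commutator_zpow_left h2]
    exact hYcomm _ _
  -- The twisted product of `y` and `y'` is corrected by the central element `⁅y, y'⁆ ^ (-c)` of
  -- `Y`.
  have hYmul' {y y' : G} (hy : y ∈ Y) (hy' : y' ∈ Y) : y * y' ∈ Y := by
    have h := hYmul (hYmul hy hy') (hYcommpow y y' (-c))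
    rwa [commutator_eq_one_of_mem_center' (Subgroup.zpow_mem _ (commutator_mem_center h2 y y') _),
      one_zpow, mul_one, mul_assoc, ← zpow_add, add_neg_cancel, zpow_zero, mul_one] at h
  intro x y
  have hy : y ∈ Subgroup.closure (Set.range X) := hX.closure ▸ Subgroup.mem_top y
  suffices y ∈ Y from this x
  induction hy using Subgroup.closure_induction with
  | mem u hu =>
    obtain ⟨k, rfl⟩ := hu
    obtain ⟨φ, hφ⟩ := hX.exists_perm (Equiv.swap j k)
    have := hYaut φ (y := X j) hj
    rwa [hφ, Equiv.swap_apply_left] at this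
  | one => exact hYone
  | mul u v _ _ hu hv => exact hYmul' hu hv
  | inv u _ hu => exact hYinv hu

end Twist

/-! ### The relatively free group: universal property and noncommutativity. -/

section FreeClassTwo

variable {n p : ℕ}

theorem FreeClassTwo.class_two (x y z : FreeClassTwo n p) : ⁅⁅x, y⁆, z⁆ = 1 := by
  induction x using QuotientGroup.induction_on with | H x =>
  induction y using QuotientGroup.induction_on with | H y =>
  induction z using QuotientGroup.induction_on with | H z =>
  exact (QuotientGroup.eq_one_iff ⁅⁅x, y⁆, z⁆).mpr
    (Subgroup.subset_normalClosure (Or.inr ⟨x, y, z, rfl⟩))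

theorem FreeClassTwo.exponent (x : FreeClassTwo n p) : x ^ p = 1 := by
  induction x using QuotientGroup.induction_on with | H x =>
  exact (QuotientGroup.eq_one_iff (x ^ p)).mpr
    (Subgroup.subset_normalClosure (Or.inl ⟨x, rfl⟩))

theorem FreeClassTwo.exists_lift {H : Type*} [Group H] (h2 : ∀ x y z : H, ⁅⁅x, y⁆, z⁆ = 1)
    (hexp : ∀ x : H, x ^ p = 1) (h : Fin n → H) :
    ∃ φ : FreeClassTwo n p →* H, ∀ i, φ (FreeGroup.of i : FreeGroup (Fin n)) = h i := by
  refine ⟨QuotientGroup.lift (lawSubgroup n p) (FreeGroup.lift h) ?_, fun i => ?_⟩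
  swap
  · change FreeGroup.lift h (FreeGroup.of i) = h i
    simp
  refine Subgroup.normalClosure_le_normal ?_
  rintro w (⟨x, rfl⟩ | ⟨x, y, z, rfl⟩)
  · simp [MonoidHom.mem_ker, hexp]
  · simp [MonoidHom.mem_ker, map_commutatorElement, h2]

theorem isFreeSystem_of_mulEquiv {G : Type*} [Group G] (e : G ≃* FreeClassTwo n p) :
    IsFreeSystem p fun i => e.symm (FreeGroup.of i : FreeGroup (Fin n)) := by
  have h2 (x y z : G) : ⁅⁅x, y⁆, z⁆ = 1 := e.injective (by
    rw [map_commutatorElement, map_commutatorElement, FreeClassTwo.class_two, map_one])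
  have hexp (x : G) : x ^ p = 1 := e.injective (by
    rw [map_pow, FreeClassTwo.exponent, map_one])
  refine ⟨h2, hexp, ?_, fun h => ?_, fun i => ?_⟩
  · let q : FreeGroup (Fin n) →* G :=
      (e.symm : FreeClassTwo n p →* G).comp (QuotientGroup.mk' (lawSubgroup n p))
    have hq : Function.Surjective q :=
      e.symm.surjective.comp (QuotientGroup.mk'_surjective _)
    rw [← Subgroup.map_top_of_surjective q hq, ← FreeGroup.closure_range_of,
      MonoidHom.map_closure, ← Set.range_comp]
    rfl
  · obtain ⟨φ, hφ⟩ := FreeClassTwo.exists_lift h2 hexp h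
    exact ⟨φ.comp e, fun i => by simp [hφ]⟩
  · obtain ⟨φ, hφ⟩ := FreeClassTwo.exists_lift (n := n) (p := p) (H := Multiplicative (ZMod p))
      (fun x y z => by rw [commutatorElement_eq_one_iff_mul_comm, mul_comm])
      (fun x => by
        rw [← ofAdd_toAdd x, ← ofAdd_nsmul, nsmul_eq_mul, CharP.cast_eq_zero, zero_mul, ofAdd_zero])
      fun j => Multiplicative.ofAdd (if j = i then 1 else 0)
    exact ⟨φ.comp e, fun j => by simp [hφ]⟩

/-- Triples with the multiplication `(a, b, c) (a', b', c') = (a + a', b + b', c + c' + a b' - b a')`,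
a form of the Heisenberg group. -/
@[ext]
structure Heisenberg (R : Type*) where
  fst : R
  snd : R
  thd : R

namespace Heisenberg

variable {R : Type*} [CommRing R]

instance : Mul (Heisenberg R) where
  mul x y := ⟨x.fst + y.fst, x.snd + y.snd, x.thd + y.thd + (x.fst * y.snd - x.snd * y.fst)⟩

instance : One (Heisenberg R) where
  one := ⟨0, 0, 0⟩

instance : Inv (Heisenberg R) where
  inv x := ⟨-x.fst, -x.snd, -x.thd⟩

theorem mk_mul_mk (a b c a' b' c' : R) : (⟨a, b, c⟩ * ⟨a', b', c'⟩ : Heisenberg R) =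
    ⟨a + a', b + b', c + c' + (a * b' - b * a')⟩ := rfl

theorem mk_inv (a b c : R) : (⟨a, b, c⟩⁻¹ : Heisenberg R) = ⟨-a, -b, -c⟩ := rfl

theorem one_def : (1 : Heisenberg R) = ⟨0, 0, 0⟩ := rfl

instance : Group (Heisenberg R) := Group.ofLeftAxioms
  (fun ⟨_, _, _⟩ ⟨_, _, _⟩ ⟨_, _, _⟩ => by
    simp only [mk_mul_mk]
    ext <;> ring)
  (fun ⟨_, _, _⟩ => by
    rw [one_def, mk_mul_mk]
    ext <;> ring)
  (fun ⟨_, _, _⟩ => by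
    rw [one_def, mk_inv, mk_mul_mk]
    ext <;> ring)

/-- The alternating form `a b' - b a'` vanishes on two multiples of the same pair, so powers are
componentwise and exponent `p` is immediate. -/
theorem mk_pow (a b c : R) (k : ℕ) :
    (⟨a, b, c⟩ ^ k : Heisenberg R) = ⟨k * a, k * b, k * c⟩ := by
  induction k with
  | zero => simp [one_def]
  | succ k ih =>
    rw [pow_succ, ih, mk_mul_mk]
    ext <;> push_cast <;> ring

theorem commutator_mk (a b c a' b' c' : R) : ⁅Heisenberg.mk a b c, Heisenberg.mk a' b' c'⁆ =
    Heisenberg.mk 0 0 (2 * (a * b' - b * a')) := by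
  rw [commutatorElement_def, mk_inv, mk_inv, mk_mul_mk, mk_mul_mk, mk_mul_mk]
  ext <;> ring

theorem class_two (x y z : Heisenberg R) : ⁅⁅x, y⁆, z⁆ = 1 := by
  obtain ⟨a, b, c⟩ := x
  obtain ⟨a', b', c'⟩ := y
  obtain ⟨a'', b'', c''⟩ := z
  rw [commutator_mk, commutator_mk, one_def]
  ext <;> ring

theorem exponent (p : ℕ) [CharP R p] (x : Heisenberg R) : x ^ p = 1 := by
  obtain ⟨a, b, c⟩ := x
  simp [mk_pow, one_def]

end Heisenberg

/-- Two generators are sent to elements of the Heisenberg group over `ZMod p` whose commutator has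
third coordinate `2`, nonzero because `p` is odd. -/
theorem FreeClassTwo.exists_commutator_ne_one (hp : p.Prime) (hp2 : 2 < p) (hn : 2 ≤ n) :
    ∃ x y : FreeClassTwo n p, ⁅x, y⁆ ≠ 1 := by
  obtain ⟨φ, hφ⟩ := FreeClassTwo.exists_lift (n := n) (Heisenberg.class_two (R := ZMod p))
    (Heisenberg.exponent p) fun i => if i = ⟨0, by omega⟩ then ⟨1, 0, 0⟩ else ⟨0, 1, 0⟩
  refine ⟨(FreeGroup.of ⟨0, by omega⟩ : FreeGroup (Fin n)),
    (FreeGroup.of ⟨1, by omega⟩ : FreeGroup (Fin n)), fun h => two_ne_zero_zmod hp hp2 ?_⟩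
  have h' := congrArg Heisenberg.thd (congrArg φ h)
  rw [map_commutatorElement, hφ, hφ, map_one, if_pos rfl, if_neg (by simp),
    Heisenberg.commutator_mk, Heisenberg.one_def] at h'
  simpa using h'

theorem exists_commutator_ne_one_of_mulEquiv (hp : p.Prime) (hp2 : 2 < p) (hn : 2 ≤ n)
    {G : Type*} [Group G] (e : G ≃* FreeClassTwo n p) : ∃ x y : G, ⁅x, y⁆ ≠ 1 := by
  obtain ⟨x, y, h⟩ := FreeClassTwo.exists_commutator_ne_one hp hp2 hn
  refine ⟨e.symm x, e.symm y, fun h' => h ?_⟩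
  rw [← map_commutatorElement] at h'
  exact (map_eq_one_iff e.symm e.symm.injective).mp h'

end FreeClassTwo

/-! ### The holomorph as the group of affine maps. -/

section Holomorph

variable {G : Type*} [Group G]

theorem mem_holomorph_iff {σ : Equiv.Perm G} :
    σ ∈ holomorph G ↔ ∃ α : G ≃* G, ∃ g : G, ∀ x, σ x = α x * g := by
  constructor
  · intro h
    -- Conjugating right translation by `y` gives right translation by some `g`; evaluating at `σ 1`
    -- identifies `g = (σ 1)⁻¹ * σ y`. The identity says that `x ↦ σ x * (σ 1)⁻¹` is multiplicative.
    have key (x y : G) : σ (x * y) = σ x * (σ 1)⁻¹ * σ y := by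
      have hy : σ * (Equiv.mulRight y : Equiv.Perm G) * σ⁻¹ ∈ rightRegular G :=
        (Subgroup.mem_normalizer_iff.mp h _).mp
          ((mem_rightRegular G _).mpr ⟨y, fun _ => rfl⟩)
      obtain ⟨g, hg⟩ := (mem_rightRegular G _).mp hy
      have h1 (x : G) : σ (x * y) = σ x * g := by simpa using hg (σ x)
      have h2 := h1 1
      rw [one_mul] at h2
      rw [h1, h2]
      group
    let α : G ≃* G :=
      { toEquiv := σ.trans (Equiv.mulRight (σ 1)⁻¹)
        map_mul' := fun x y => by simp [key, mul_assoc] }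
    exact ⟨α, σ 1, fun x => by simp [α]⟩
  · rintro ⟨α, g, h⟩
    refine Subgroup.mem_normalizer_iff.mpr fun τ => ?_
    constructor
    · intro hτ
      obtain ⟨y, hy⟩ := (mem_rightRegular G _).mp hτ
      refine (mem_rightRegular G _).mpr ⟨g⁻¹ * α y * g, fun x => ?_⟩
      obtain ⟨x, rfl⟩ := σ.surjective x
      rw [Equiv.Perm.mul_apply, Equiv.Perm.mul_apply, Equiv.Perm.inv_def, Equiv.symm_apply_apply,
        hy, h, h, map_mul]
      group
    · intro hτ
      obtain ⟨y, hy⟩ := (mem_rightRegular G _).mp hτ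
      refine (mem_rightRegular G _).mpr ⟨α.symm (g * y * g⁻¹), fun x => σ.injective ?_⟩
      have := hy (σ x)
      rw [Equiv.Perm.mul_apply, Equiv.Perm.mul_apply, Equiv.Perm.inv_def,
        Equiv.symm_apply_apply] at this
      rw [this]
      simp [h, mul_assoc]

theorem exists_mulEquiv_of_mem_holomorph {σ : Equiv.Perm G} (h : σ ∈ holomorph G)
    (h1 : σ 1 = 1) : ∃ α : G ≃* G, ∀ x, σ x = α x := by
  obtain ⟨α, g, hα⟩ := mem_holomorph_iff.mp h
  have : g = 1 := by simpa [h1] using (hα 1).symm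
  exact ⟨α, fun x => by simp [hα, this]⟩

theorem mulRight_mem_holomorph (g : G) : (Equiv.mulRight g : Equiv.Perm G) ∈ holomorph G :=
  mem_holomorph_iff.mpr ⟨MulEquiv.refl G, g, fun _ => rfl⟩

theorem mulLeft_mem_holomorph (g : G) : (Equiv.mulLeft g : Equiv.Perm G) ∈ holomorph G :=
  mem_holomorph_iff.mpr ⟨MulAut.conj g, g, fun x => by simp⟩

theorem toEquiv_mem_holomorph (α : G ≃* G) : (α.toEquiv : Equiv.Perm G) ∈ holomorph G :=
  mem_holomorph_iff.mpr ⟨α, 1, fun x => by simp⟩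

theorem conj_mem_holomorph {τ σ : Equiv.Perm G} (hτ : τ ∈ multipleHolomorph G)
    (hσ : σ ∈ holomorph G) : τ * σ * τ⁻¹ ∈ holomorph G :=
  (Subgroup.mem_normalizer_iff.mp hτ σ).mp hσ

theorem conj_mem_holomorph' {τ σ : Equiv.Perm G} (hτ : τ ∈ multipleHolomorph G)
    (hσ : σ ∈ holomorph G) : τ⁻¹ * σ * τ ∈ holomorph G := by
  simpa using conj_mem_holomorph (inv_mem hτ) hσ

theorem holomorph_le_multipleHolomorph : holomorph G ≤ multipleHolomorph G :=
  Subgroup.le_normalizer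

end Holomorph

/-! ### Power maps and the multiple holomorph. -/

section MainArgument

variable {G : Type*} [Group G] {ι : Type*} [DecidableEq ι] {p : ℕ} {X : ι → G}

/-- An element of the multiple holomorph fixing the identity is an isomorphism from `G` onto a
twist of `G` by a power of the commutator. -/
theorem IsFreeSystem.exists_map_mul_eq [Finite ι] (hX : IsFreeSystem p X) (hp : p.Prime)
    (hp2 : 2 < p) {i j : ι} (hij : i ≠ j) {τ : Equiv.Perm G} (hτ : τ ∈ multipleHolomorph G)
    (h1 : τ 1 = 1) : ∃ c : ℤ, ∀ x y, τ (x * y) = τ x * τ y * ⁅τ x, τ y⁆ ^ c := by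
  have h1' : Equiv.symm τ 1 = 1 := by rw [Equiv.symm_apply_eq, h1]
  suffices h : ∃ c : ℤ, ∀ x y, τ (τ⁻¹ x * τ⁻¹ y) = x * y * ⁅x, y⁆ ^ c by
    obtain ⟨c, hc⟩ := h
    exact ⟨c, fun x y => by simpa using hc (τ x) (τ y)⟩
  refine exists_eq_mul_commutator_zpow hX hp hp2 hij (fun x y => τ (τ⁻¹ x * τ⁻¹ y)) ?_ ?_ ?_ ?_
  · intro φ x y
    -- `τ⁻¹ φ τ` lies in the holomorph and fixes `1`, so it is an automorphism `ψ`; this gives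
    -- invariance of the transported operation.
    obtain ⟨ψ, hψ⟩ := exists_mulEquiv_of_mem_holomorph
      (conj_mem_holomorph' hτ (toEquiv_mem_holomorph φ)) (by simp [h1, h1'])
    have hφ (x : G) : φ (τ x) = τ (ψ x) := by
      rw [← hψ]; simp
    have hφ' (x : G) : τ⁻¹ (φ x) = ψ (τ⁻¹ x) := by
      rw [Equiv.Perm.inv_eq_iff_eq, ← hφ]; simp
    rw [hφ, map_mul, hφ', hφ']
  · intro x y z
    simp [mul_assoc]
  · intro y
    -- Translations of the transported operation are `τ`-conjugates of translations of `G`;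
    -- evaluating at `1` identifies the constant `g`.
    obtain ⟨α, g, hα⟩ := mem_holomorph_iff.mp
      (conj_mem_holomorph hτ (mulRight_mem_holomorph (τ⁻¹ y)))
    have hg : g = y := by simpa [h1'] using (hα 1).symm
    exact ⟨α, fun x => by simpa [hg] using hα x⟩
  · intro x
    obtain ⟨α, g, hα⟩ := mem_holomorph_iff.mp
      (conj_mem_holomorph hτ (mulLeft_mem_holomorph (τ⁻¹ x)))
    have hg : g = x := by simpa [h1'] using (hα 1).symm
    exact ⟨α, fun y => by simpa [hg] using hα y⟩

/-- The power maps with exponents prime to `p` of a group of exponent `p`. -/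
def powPerm (hp : p.Prime) (hexp : ∀ x : G, x ^ p = 1) : (ZMod p)ˣ →* Equiv.Perm G :=
  have key (u v : (ZMod p)ˣ) (x : G) :
      (x ^ (v : ZMod p).val) ^ (u : ZMod p).val = x ^ ((u * v : (ZMod p)ˣ) : ZMod p).val := by
    have := Fact.mk hp
    rw [← pow_mul, ← zpow_natCast, ← zpow_natCast]
    exact zpow_eq_zpow_of_cast_eq hexp (by push_cast; simp [mul_comm]) x
  have one (x : G) : x ^ ((1 : (ZMod p)ˣ) : ZMod p).val = x := by
    have := Fact.mk hp
    rw [Units.val_one, ZMod.val_one, pow_one]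
  { toFun := fun u =>
      { toFun := fun x => x ^ (u : ZMod p).val
        invFun := fun x => x ^ ((u⁻¹ : (ZMod p)ˣ) : ZMod p).val
        left_inv := fun x => by simp only [key, inv_mul_cancel, one]
        right_inv := fun x => by simp only [key, mul_inv_cancel, one] }
    map_one' := Equiv.ext one
    map_mul' := fun u v => Equiv.ext fun x => (key u v x).symm }

theorem powPerm_apply (hp : p.Prime) (hexp : ∀ x : G, x ^ p = 1) (u : (ZMod p)ˣ) (x : G) :
    powPerm hp hexp u x = x ^ (u : ZMod p).val := rfl

theorem powPerm_apply_eq_zpow (hp : p.Prime) (hexp : ∀ x : G, x ^ p = 1) {u : (ZMod p)ˣ} {d : ℤ}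
    (hd : (u : ZMod p) = d) (x : G) : powPerm hp hexp u x = x ^ d := by
  have := Fact.mk hp
  rw [powPerm_apply, ← zpow_natCast]
  exact zpow_eq_zpow_of_cast_eq hexp (by simpa using hd) x

/-- Conjugating `x ↦ α x * g` by the power map gives `(α x ^ d' * g) ^ d` with `d'` inverse to `d`.
Expanding, this is `α x * g ^ d` times a power of `⁅g, α x⁆`, and that factor is absorbed by an
inner automorphism. -/
theorem powPerm_mem_multipleHolomorph (hp : p.Prime) (hexp : ∀ x : G, x ^ p = 1)
    (h2 : ∀ x y z : G, ⁅⁅x, y⁆, z⁆ = 1) (u : (ZMod p)ˣ) :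
    powPerm hp hexp u ∈ multipleHolomorph G := by
  have key (u : (ZMod p)ˣ) (σ : Equiv.Perm G) (hσ : σ ∈ holomorph G) :
      powPerm hp hexp u * σ * (powPerm hp hexp u)⁻¹ ∈ holomorph G := by
    obtain ⟨α, g, hα⟩ := mem_holomorph_iff.mp hσ
    set d := (u : ZMod p).val
    set d' := ((u⁻¹ : (ZMod p)ˣ) : ZMod p).val
    have hdd (x : G) : (x ^ d') ^ d = x := by
      have := DFunLike.congr_fun ((powPerm hp hexp).map_mul u u⁻¹) x
      rw [mul_inv_cancel, map_one] at this
      exact this.symm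
    refine mem_holomorph_iff.mpr
      -- The conjugating element is `g ^ (d' * d.choose 2)`, written as a double inverse to match
      -- `conj_zpow_neg_eq` with `c = 1`.
      ⟨α.trans (MulAut.conj ((g ^ (-(d' * d.choose 2 : ℕ) : ℤ)) ^ (-1 : ℤ))), g ^ d, fun x => ?_⟩
    rw [← map_inv, Equiv.Perm.mul_apply, Equiv.Perm.mul_apply, powPerm_apply, powPerm_apply, hα,
      map_pow, mul_pow_eq_of_class_two h2, hdd, MulEquiv.trans_apply, conj_zpow_neg_eq h2,
      zpow_one, mul_assoc, mul_assoc, ← ((commute_commutator h2 _ _ _).pow_left _).eq]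
    congr 2
    rw [commutator_zpow_right h2, ← zpow_natCast _ d', commutator_zpow_right h2,
      ← commutatorElement_inv g, inv_zpow', neg_neg, zpow_natCast, zpow_natCast, pow_mul]
  refine Subgroup.mem_normalizer_iff.mpr fun σ => ⟨key u σ, fun h => ?_⟩
  have := key u⁻¹ _ h
  rwa [map_inv, inv_inv, mul_assoc, mul_assoc, inv_mul_cancel, mul_one,
    inv_mul_cancel_left] at this

/-- The homomorphism to `T(G)` given by the classes of the power maps. -/
def powClass (hp : p.Prime) (hexp : ∀ x : G, x ^ p = 1)
    (h2 : ∀ x y z : G, ⁅⁅x, y⁆, z⁆ = 1) : (ZMod p)ˣ →* T G :=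
  (QuotientGroup.mk' _).comp
    ((powPerm hp hexp).codRestrict _ (powPerm_mem_multipleHolomorph hp hexp h2))

/-- A power map in the holomorph fixes `1`, so it is an automorphism; then `⁅x, y⁆ ^ d = ⁅x, y⁆ ^ (d
* d)`, which forces `d = 1` modulo `p`. -/
theorem powClass_injective (hp : p.Prime) (hexp : ∀ x : G, x ^ p = 1)
    (h2 : ∀ x y z : G, ⁅⁅x, y⁆, z⁆ = 1) {x y : G} (hxy : ⁅x, y⁆ ≠ 1) :
    Function.Injective (powClass hp hexp h2) := by
  have := Fact.mk hp
  refine (injective_iff_map_eq_one _).mpr fun u hu => ?_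
  have hmem : powPerm hp hexp u ∈ holomorph G :=
    Subgroup.mem_subgroupOf.mp ((QuotientGroup.eq_one_iff _).mp hu)
  obtain ⟨α, hα⟩ := exists_mulEquiv_of_mem_holomorph hmem (by rw [powPerm_apply, one_pow])
  set d := (u : ZMod p).val with hd
  have h1 : ⁅x, y⁆ ^ d = ⁅x, y⁆ ^ ((d : ℤ) * d) := by
    have h := map_commutatorElement α x y
    rw [← hα, ← hα, ← hα, powPerm_apply, powPerm_apply, powPerm_apply, ← zpow_natCast x,
      ← zpow_natCast y, commutator_zpow_left h2, commutator_zpow_right h2, ← zpow_mul] at h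
    exact h
  have h3 : ⁅x, y⁆ ^ ((d : ℤ) * d - d) = 1 := by
    rw [zpow_sub, ← h1, zpow_natCast, mul_inv_cancel]
  by_contra hne
  refine hxy (eq_one_of_zpow_eq_one hp hexp ?_ h3)
  push_cast
  rw [hd, ZMod.natCast_zmod_val, ← sub_one_mul]
  exact mul_ne_zero (sub_ne_zero.mpr fun h => hne (Units.ext h)) u.ne_zero

theorem IsFreeSystem.powClass_surjective [Finite ι] (hX : IsFreeSystem p X) (hp : p.Prime)
    (hp2 : 2 < p) {i j : ι} (hij : i ≠ j) {x y : G} (hxy : ⁅x, y⁆ ≠ 1) :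
    Function.Surjective (powClass hp hX.exponent hX.class_two) := by
  have := Fact.mk hp
  have h2 := hX.class_two
  intro t
  obtain ⟨⟨τ₀, hτ₀⟩, rfl⟩ := QuotientGroup.mk_surjective t
  set ρ : Equiv.Perm G := Equiv.mulRight (τ₀ 1)⁻¹
  have hρ : ρ ∈ holomorph G := mulRight_mem_holomorph _
  set τ := ρ * τ₀ with hτdef
  have hτ : τ ∈ multipleHolomorph G := mul_mem (holomorph_le_multipleHolomorph hρ) hτ₀
  have h1 : τ 1 = 1 := by simp [τ, ρ]
  obtain ⟨c, hc⟩ := hX.exists_map_mul_eq hp hp2 hij hτ h1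
  -- Exchanging the factors in the twisted product changes it by `⁅τ x, τ y⁆ ^ (1 + 2 * c)`; were
  -- this always trivial, `x` and `y` would commute.
  have hc0 : (1 + 2 * c : ZMod p) ≠ 0 := by
    intro h0
    refine hxy (commutatorElement_eq_one_iff_mul_comm.mpr (τ.injective ?_))
    rw [hc, hc, ← commutatorElement_inv (τ x), inv_zpow']
    have h3 : ⁅τ x, τ y⁆ ^ (1 + 2 * c) = 1 :=
      zpow_eq_one_of_cast_eq_zero hX.exponent (by push_cast; exact h0) _
    calc τ x * τ y * ⁅τ x, τ y⁆ ^ c = ⁅τ x, τ y⁆ * (τ y * τ x) * ⁅τ x, τ y⁆ ^ c := by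
          simp only [commutatorElement_def]; group
      _ = τ y * τ x * (⁅τ x, τ y⁆ * ⁅τ x, τ y⁆ ^ c) := by
          rw [(commute_commutator h2 _ _ _).eq, mul_assoc]
      _ = τ y * τ x * (⁅τ x, τ y⁆ ^ (1 + 2 * c) * ⁅τ x, τ y⁆ ^ (-c)) := by
          rw [← zpow_one_add, ← zpow_add]; congr 2; ring
      _ = _ := by rw [h3, one_mul]
  -- For the power map to satisfy the same product formula as `τ`, the exponents of `⁅x, y⁆` must
  -- agree: `-d (d - 1) / 2 = d² c`, that is, `d (1 + 2c) = 1`.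
  set u : (ZMod p)ˣ := (Units.mk0 _ hc0)⁻¹ with hu
  set d := (u : ZMod p).val with hd
  have hdc : (d : ZMod p) * (1 + 2 * c) = 1 := by
    rw [hd, ZMod.natCast_zmod_val, hu]
    exact Units.inv_mul (Units.mk0 _ hc0)
  set θ := powPerm hp hX.exponent u
  have hθ (x y : G) : θ (x * y) = θ x * θ y * ⁅θ x, θ y⁆ ^ c := by
    simp only [θ, powPerm_apply, ← hd]
    rw [mul_pow_eq_of_class_two h2, ← zpow_natCast x d, ← zpow_natCast y d,
      commutator_zpow_left h2, commutator_zpow_right h2, ← commutatorElement_inv x y,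
      ← zpow_natCast, inv_zpow', ← zpow_mul, ← zpow_mul]
    congr 1
    refine zpow_eq_zpow_of_cast_eq hX.exponent ?_ _
    have hch : (2 : ZMod p) * (d.choose 2 : ℕ) = d * (d - 1) := by
      have h4 : d.choose 2 * 2 = d * (d - 1) := by
        rw [Nat.choose_two_right]
        exact Nat.div_mul_cancel (Nat.even_mul_pred_self d).two_dvd
      have hd1 : 1 ≤ d := Nat.one_le_iff_ne_zero.mpr fun h => by simp [h] at hdc
      have h5 := congrArg (Nat.cast : ℕ → ZMod p) h4
      push_cast [hd1] at h5
      linear_combination h5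
    push_cast
    refine mul_left_cancel₀ (two_ne_zero_zmod hp hp2) ?_
    linear_combination -hch - (d : ZMod p) * hdc
  have hθ' (a b : G) : θ⁻¹ (a * b * ⁅a, b⁆ ^ c) = θ⁻¹ a * θ⁻¹ b := by
    rw [Equiv.Perm.inv_eq_iff_eq, hθ]; simp
  let α : G ≃* G :=
    { toEquiv := θ⁻¹ * τ
      map_mul' := fun x y => (congrArg _ (hc x y)).trans (hθ' _ _) }
  refine ⟨u, ?_⟩
  change QuotientGroup.mk' _ _ = _
  refine QuotientGroup.eq.mpr (Subgroup.mem_subgroupOf.mpr ?_)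
  change θ⁻¹ * τ₀ ∈ holomorph G
  -- The translation `ρ` used to normalize `τ₀` is moved past `θ`, which normalizes the holomorph.
  have h6 : θ⁻¹ * τ₀ = (θ⁻¹ * ρ⁻¹ * θ) * (α.toEquiv : Equiv.Perm G) := by
    change _ = _ * (θ⁻¹ * τ)
    rw [hτdef]; group
  rw [h6]
  exact mul_mem (conj_mem_holomorph'
    (powPerm_mem_multipleHolomorph hp hX.exponent h2 u) (inv_mem hρ)) (toEquiv_mem_holomorph α)

end MainArgument

end MultipleHolomorph

theorem mainTheorem4 (p n : ℕ) (hp : p.Prime) (hp2 : 2 < p) (hn : 2 ≤ n)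
    (G : Type*) [Group G] (hG : Nonempty (G ≃* MultipleHolomorph.FreeClassTwo n p)) :
    IsCyclic (MultipleHolomorph.T G) ∧
    Nat.card (MultipleHolomorph.T G) = p - 1 ∧
    (∀ d : ℤ, IsCoprime d (p : ℤ) →
      ∃ θ : Equiv.Perm G, θ ∈ MultipleHolomorph.multipleHolomorph G ∧ ∀ x : G, θ x = x ^ d) ∧
    (∀ t : MultipleHolomorph.T G, ∃ d : ℤ, IsCoprime d (p : ℤ) ∧
      ∃ θ : MultipleHolomorph.multipleHolomorph G,
        (∀ x : G, (θ : Equiv.Perm G) x = x ^ d) ∧ (θ : MultipleHolomorph.T G) = t) := by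
  have := Fact.mk hp
  obtain ⟨e⟩ := hG
  have hX := MultipleHolomorph.isFreeSystem_of_mulEquiv e
  have hij : (⟨0, by omega⟩ : Fin n) ≠ ⟨1, by omega⟩ := by simp
  obtain ⟨x, y, hxy⟩ := MultipleHolomorph.exists_commutator_ne_one_of_mulEquiv hp hp2 hn e
  have hsurj := hX.powClass_surjective hp hp2 hij hxy
  have hinj := MultipleHolomorph.powClass_injective hp hX.exponent hX.class_two hxy
  refine ⟨isCyclic_of_surjective _ hsurj, ?_, fun d hd => ?_, fun t => ?_⟩
  · rw [← Nat.card_eq_of_bijective _ ⟨hinj, hsurj⟩, Nat.card_eq_fintype_card, ZMod.card_units]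
  · exact ⟨_, MultipleHolomorph.powPerm_mem_multipleHolomorph hp hX.exponent hX.class_two
        (ZMod.unitOfIsCoprime d hd),
      MultipleHolomorph.powPerm_apply_eq_zpow hp hX.exponent (ZMod.coe_unitOfIsCoprime d hd)⟩
  · obtain ⟨u, rfl⟩ := hsurj t
    refine ⟨(u : ZMod p).val, ?_, _, fun x => ?_, rfl⟩
    · exact Nat.isCoprime_iff_coprime.mpr (ZMod.val_coe_unit_coprime u)
    · exact (zpow_natCast x _).symm
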